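/- Throughout, $\mathbb N_0=\{0,1,2,\dots\}$ and $\mathbf M=(M_p)_{p\in\mathbb N_0}$ is a \emph{weight sequence}: $M_p>0$ for all $p$, $M_0=1$, $M_p^2\le M_{p-1}M_{p+1}$ for all $p\ge1$, and $\lim_{p\to\infty}M_p^{1/p}=\infty$. Put $m_p=M_{p+1}/M_p$ for $p\in\mathbb N_0$, $$\nu_{\mathbf m}(t)=\#\{j\in\mathbb N_0: m_j\le t\},\qquad \omega_{\mathbf M}(t)=\sup_{p\in\mathbb N_0}\log\frac{t^p}{M_p}\quad(t>0),\qquad \omega_{\mathbf M}(0)=0 .$$ For a function $f$ that is positive near $\infty$, the upper and lower Matuszewska indices are $$\alpha(f)=\inf\Big\{\alpha\in\mathbb R:\ \exists C>0\ \forall\Lambda>1,\ \limsup_{x\to\infty}\sup_{\lambda\in[1,\Lambda]}\frac{f(\lambda x)}{\lambda^{\alpha}f(x)}\le C\Big\},$$ $$\beta(f)=\sup\Big\{\beta\in\mathbb R:\ \exists D>0\ \forall\Lambda>1,\ \liminf_{x\to\infty}\inf_{\lambda\in[1,\Lambda]}\frac{f(\lambda x)}{\lambda^{\beta}f(x)}\ge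 D\Big\},$$ taken in $[-\infty,\infty]$ (with $\inf\emptyset=\sup\mathbb R=\infty$ and $\sup\emptyset=\inf\mathbb R=-\infty$). For the sequence of quotients, $\alpha(\mathbf m)$ and $\beta(\mathbf m)$ are the indices of the step function $x\mapsto m_{\lfloor x\rfloor-1}$, $x\ge1$. The growth index $\gamma(\mathbf M)\in[-\infty,\infty]$ is the supremum of all $\gamma\in\mathbb R$ for which there are a real sequence $(\ell_p)_{p\in\mathbb N_0}$ and a constant $a\ge1$ with $a^{-1}m_p\le\ell_p\le a\,m_p$ for all $p\in\mathbb N_0$ and $\big((p+1)^{-\gamma}\ell_p\big)_{p\in\mathbb N_0}$ nondecreasing. For a nondecreasing $\sigma:[0,\infty)\to[0,\infty)$ with $\sigma(t)\to\infty$ as $t\to\infty$, $\gamma(\sigma)\in[0,\infty]$ is the supremum of all $\gamma>0$ for which there is $K>1$ with $\limsup_{t\to\infty}\sigma(K^\gamma t)/\sigma(t)<K$, and $\gamma(\sigma)=0$ if there is no such $\gamma$. Then $\alpha(\nu_{\mathbf m}),\beta(\nu_{\mathbf m}),\alpha(\omega_{\mathbf M}),\beta(\omega_{\mathbf M})$ belong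 to $[0,\infty]$, and $$\alpha(\nu_{\mathbf m})\ge\alpha(\omega_{\mathbf M}),\qquad \beta(\nu_{\mathbf m})=\beta(\omega_{\mathbf M}).$$ Moreover, with the conventions $1/0=\infty$ and $1/\infty=0$: (i) $\displaystyle \gamma(\mathbf M)=\beta(\mathbf m)=\frac1{\alpha(\nu_{\mathbf m})}\le\frac1{\alpha(\omega_{\mathbf M})}=\gamma(\omega_{\mathbf M})$; (ii) $\displaystyle \alpha(\mathbf m)=\frac1{\beta(\nu_{\mathbf m})}=\frac1{\beta(\omega_{\mathbf M})}$; (iii) if there is $A>0$ with $M_{p+q}\le A^{p+q}M_pM_q$ for all $p,q\in\mathbb N_0$ (moderate growth), then $\gamma(\mathbf M)=\gamma(\omega_{\mathbf M})$. -/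

import Mathlib

open Filter Topology

noncomputable section

namespace GrowthIndex

/-- `x ↦ 1/x` on the extended reals with the conventions `1/0 = ∞` and `1/∞ = 0`
(it is meant for arguments in `[0, ∞]`; `EReal` itself has `0⁻¹ = 0`). -/
def recip (x : EReal) : EReal := if x = 0 then ⊤ else x⁻¹

/-! ### Matuszewska indices of functions that are eventually positive -/

/-- The upper Matuszewska index: the infimum, in the extended reals, of all real `a` for which
there is `C > 0` such that for every `Λ > 1`
`limsup_{x → ∞} sup_{l ∈ [1, Λ]} f (l x) / (l ^ a f x) ≤ C`. -/
def upperMatuszewska (f : ℝ → ℝ) : EReal :=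
  sInf {a : EReal | ∃ r : ℝ, a = (r : EReal) ∧ ∃ C : ℝ, 0 < C ∧ ∀ L : ℝ, 1 < L →
    limsup (fun x : ℝ => ⨆ l ∈ Set.Icc (1 : ℝ) L, ((f (l * x) / (l ^ r * f x) : ℝ) : EReal)) atTop
      ≤ (C : EReal)}

/-- The lower Matuszewska index: the supremum, in the extended reals, of all real `b` for which
there is `D > 0` such that for every `Λ > 1`
`liminf_{x → ∞} inf_{l ∈ [1, Λ]} f (l x) / (l ^ b f x) ≥ D`. -/
def lowerMatuszewska (f : ℝ → ℝ) : EReal :=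
  sSup {b : EReal | ∃ r : ℝ, b = (r : EReal) ∧ ∃ D : ℝ, 0 < D ∧ ∀ L : ℝ, 1 < L →
    (D : EReal) ≤
      liminf (fun x : ℝ => ⨅ l ∈ Set.Icc (1 : ℝ) L, ((f (l * x) / (l ^ r * f x) : ℝ) : EReal))
        atTop}

/-- The index `γ(σ)` of a nondecreasing unbounded function: the supremum in `[0, ∞]` of all
`g > 0` for which there is `K > 1` with `limsup_{t → ∞} σ (K ^ g t) / σ t < K`, and `0` if there
is no such `g`. -/
def gammaFun (σ : ℝ → ℝ) : EReal :=
  0 ⊔ sSup {c : EReal | ∃ g : ℝ, c = (g : EReal) ∧ 0 < g ∧ ∃ K : ℝ, 1 < K ∧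
    limsup (fun t : ℝ => ((σ (K ^ g * t) / σ t : ℝ) : EReal)) atTop < (K : EReal)}

/-! ### Sequences -/

/-- A weight sequence: positive reals, `M 0 = 1`, logarithmically convex, and
`(M p) ^ (1 / p) → ∞`. -/
structure IsWeightSequence (M : ℕ → ℝ) : Prop where
  pos : ∀ p, 0 < M p
  zero : M 0 = 1
  logConvex : ∀ p, 1 ≤ p → M p ^ 2 ≤ M (p - 1) * M (p + 1)
  tendsto : Tendsto (fun p : ℕ => M p ^ (1 / (p : ℝ))) atTop atTop

/-- Moderate growth. -/
def ModerateGrowth (M : ℕ → ℝ) : Prop :=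
  ∃ A : ℝ, 0 < A ∧ ∀ p q : ℕ, M (p + q) ≤ A ^ (p + q) * M p * M q

/-- The sequence of quotients `m p = M (p + 1) / M p`, `p ≥ 0`. -/
def quot (M : ℕ → ℝ) (p : ℕ) : ℝ := M (p + 1) / M p

/-- The step function `x ↦ a ⌊x⌋`, `x ≥ 1`, of a sequence `(a p)` with `p ≥ 1`. -/
def stepFun (a : ℕ → ℝ) (x : ℝ) : ℝ := a ⌊x⌋₊

/-- Upper Matuszewska index of a sequence `(a p)`, `p ≥ 1` (the value `a 0` is irrelevant). -/
def upperMatuszewskaSeq (a : ℕ → ℝ) : EReal := upperMatuszewska (stepFun a)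

/-- Lower Matuszewska index of a sequence `(a p)`, `p ≥ 1` (the value `a 0` is irrelevant). -/
def lowerMatuszewskaSeq (a : ℕ → ℝ) : EReal := lowerMatuszewska (stepFun a)

/-- The sequence of quotients indexed from `1`: `p ↦ m (p - 1)` for `p ≥ 1`. -/
def quotFromOne (M : ℕ → ℝ) (p : ℕ) : ℝ := quot M (p - 1)

/-- Thilliez's property `(P_g)`: the sequence of quotients is equivalent, up to a constant factor,
to a real sequence `l` for which `(p + 1) ^ (-g) * l p` is nondecreasing. -/
def ThilliezProperty (M : ℕ → ℝ) (g : ℝ) : Prop :=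
  ∃ l : ℕ → ℝ, (∃ a : ℝ, 1 ≤ a ∧ ∀ p, a⁻¹ * quot M p ≤ l p ∧ l p ≤ a * quot M p) ∧
    Monotone (fun p : ℕ => ((p : ℝ) + 1) ^ (-g) * l p)

/-- The growth index `γ(M)`, the supremum in the extended reals of all real `g` with `(P_g)`. -/
def gammaSeq (M : ℕ → ℝ) : EReal :=
  sSup {c : EReal | ∃ g : ℝ, c = (g : EReal) ∧ ThilliezProperty M g}

/-- The associated function: `sup_p log (t ^ p / M p)` for `t > 0`, and `0` at `0`. For a weight
sequence the supremum is finite, see `bddAbove_log`. -/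
def assocFun (M : ℕ → ℝ) (t : ℝ) : ℝ :=
  if 0 < t then ⨆ p : ℕ, Real.log (t ^ p / M p) else 0

/-- The counting function `t ↦ #{j : m j ≤ t}` of the sequence of quotients. For a weight
sequence these sets are finite, see `finite_quot_le`. -/
def countFun (M : ℕ → ℝ) (t : ℝ) : ℝ := ({j : ℕ | quot M j ≤ t}.ncard : ℝ)

theorem IsWeightSequence.eventually_pow_le {M : ℕ → ℝ} (hM : IsWeightSequence M) (t : ℝ) :
    ∀ᶠ p : ℕ in atTop, t ^ p ≤ M p := by
  filter_upwards [hM.tendsto.eventually_ge_atTop |t|, eventually_gt_atTop 0] with p hp h0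
  have h1 : (M p ^ (1 / (p : ℝ))) ^ p = M p := by
    rw [one_div]
    exact Real.rpow_inv_natCast_pow (hM.pos p).le h0.ne'
  calc t ^ p ≤ |t| ^ p := by rw [← abs_pow]; exact le_abs_self _
    _ ≤ (M p ^ (1 / (p : ℝ))) ^ p := pow_le_pow_left₀ (abs_nonneg t) hp p
    _ = M p := h1

theorem IsWeightSequence.bddAbove_log {M : ℕ → ℝ} (hM : IsWeightSequence M) {t : ℝ} (ht : 0 < t) :
    BddAbove (Set.range fun p : ℕ => Real.log (t ^ p / M p)) := by
  apply IsBoundedUnder.bddAbove_range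
  refine ⟨0, ?_⟩
  rw [eventually_map]
  filter_upwards [hM.eventually_pow_le t] with p hp
  have := hM.pos p
  exact Real.log_nonpos (by positivity) ((div_le_one this).2 hp)

theorem IsWeightSequence.quot_mono {M : ℕ → ℝ} (hM : IsWeightSequence M) : Monotone (quot M) := by
  refine monotone_nat_of_le_succ fun p => ?_
  have h := hM.logConvex (p + 1) (by omega)
  simp only [Nat.add_sub_cancel] at h
  unfold quot
  rw [div_le_div_iff₀ (hM.pos _) (hM.pos _)]
  nlinarith

theorem IsWeightSequence.finite_quot_le {M : ℕ → ℝ} (hM : IsWeightSequence M) (t : ℝ) :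
    {j : ℕ | quot M j ≤ t}.Finite := by
  by_contra hinf
  have hall : ∀ j, quot M j ≤ t := fun j => by
    obtain ⟨k, hk, hjk⟩ := Set.Infinite.exists_gt hinf j
    exact (hM.quot_mono hjk.le).trans hk
  have ht : 0 < t := (div_pos (hM.pos 1) (hM.pos 0)).trans_le (hall 0)
  have hle : ∀ p, M p ≤ t ^ p := fun p => by
    induction p with
    | zero => simp [hM.zero]
    | succ p ih =>
      have h := hall p
      unfold quot at h
      rw [div_le_iff₀ (hM.pos p)] at h
      rw [pow_succ']
      exact h.trans (mul_le_mul_of_nonneg_left ih ht.le)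
  obtain ⟨p, hp, h0⟩ := ((hM.eventually_pow_le (t + 1)).and (eventually_gt_atTop 0)).exists
  have h2 : t ^ p < (t + 1) ^ p := pow_lt_pow_left₀ (by linarith) ht.le (by omega)
  linarith [hle p]

end GrowthIndex

end

/-!
All indices are governed by plain power bounds. For a function `f` that is positive near infinity,
`upperMatuszewska f` is the infimum of the `r` with `f (l x) ≤ C l ^ r f x` for all `l ≥ 1` and all
large `x`: the definition asks for this only locally in `l`, but a slight increase of `r` absorbs
the constant at one scale `L`, and then the estimate can be iterated (`le_of_forall_Icc_of_step`,
`LocalUpperBound.toUpperBound`). The lower index is treated through `1 / f`. Iterating the condition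
in `gammaFun` in the same way gives `recip (upperMatuszewska f) = gammaFun f` for monotone `f`.

The counting function `ν` is the generalized inverse of the quotients `m`:
`m j ≤ t` if and only if `j < ν t`. Hence an upper bound on `ν` of exponent `r` is a lower bound on
`m` of exponent `1 / r`, and conversely, and likewise with upper and lower exchanged. Moreover, `(P_g)`
for `g > 0` is the lower bound of exponent `g` for `m`; the equivalent sequence comes from a running
maximum.

The associated function `ω` is compared with `ν` through
`ν t * log s ≤ ω (s t) - ω t ≤ ν (s t) * log s`, which holds because the supremum defining `ω t` is
attained at `p = ν t`. For `s = e`, bounds on `ν` become bounds on the increments of `ω` and add up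
to bounds on `ω`. Conversely, if `ω` has a lower bound of positive exponent, then `ω (K t) ≥ 2 ω t`
for some `K` and large `t`, so that `ω t ≤ ν (K t) * log K`; this gives the lower bound for `ν`.
Moderate growth yields `ω (A t) ≥ 2 ω t` directly, and then upper bounds on `ω` pass to `ν` as well.
-/

namespace GrowthIndex

/-! ### The reciprocal on the extended half-line -/

theorem coe_lt_recip_iff {y : EReal} (hy : 0 ≤ y) {c : ℝ} (hc : 0 < c) :
    (c : EReal) < recip y ↔ y < ((1 / c : ℝ) : EReal) := by
  induction y with
  | bot => simp at hy
  | top => simp [recip, hc.le]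
  | coe y =>
    have hy' : 0 ≤ y := EReal.coe_nonneg.1 hy
    rcases hy'.eq_or_lt with rfl | hy0
    · have : (0 : EReal) < ((1 / c : ℝ) : EReal) := EReal.coe_pos.2 (by positivity)
      simpa [recip, EReal.coe_lt_top] using hc
    · have h : recip (y : EReal) = ((y⁻¹ : ℝ) : EReal) := by
        rw [recip, if_neg (by exact_mod_cast hy0.ne'), EReal.coe_inv]
      rw [h, EReal.coe_lt_coe_iff, EReal.coe_lt_coe_iff, one_div, lt_inv_comm₀ hc hy0]

theorem recip_lt_coe_iff {y : EReal} (hy : 0 ≤ y) {c : ℝ} (hc : 0 < c) :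
    recip y < (c : EReal) ↔ ((1 / c : ℝ) : EReal) < y := by
  induction y with
  | bot => simp at hy
  | top => simpa [recip, EReal.coe_lt_top] using hc
  | coe y =>
    have hy' : 0 ≤ y := EReal.coe_nonneg.1 hy
    rcases hy'.eq_or_lt with rfl | hy0
    · simp [recip, hc.le]
    · have h : recip (y : EReal) = ((y⁻¹ : ℝ) : EReal) := by
        rw [recip, if_neg (by exact_mod_cast hy0.ne'), EReal.coe_inv]
      rw [h, EReal.coe_lt_coe_iff, EReal.coe_lt_coe_iff, one_div, inv_lt_comm₀ hy0 hc]

theorem recip_le_of_forall {x y : EReal} (hx : 0 ≤ x) (hy : 0 ≤ y)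
    (h : ∀ r : ℝ, 0 < r → y < (r : EReal) → ((1 / r : ℝ) : EReal) ≤ x) : recip y ≤ x := by
  refine EReal.ge_of_forall_gt_iff_ge.1 fun c hc => ?_
  rcases le_or_gt c 0 with hc0 | hc0
  · exact (EReal.coe_nonpos.2 hc0).trans hx
  · simpa using h (1 / c) (by positivity) ((coe_lt_recip_iff hy hc0).1 hc)

theorem recip_nonneg {y : EReal} (hy : 0 ≤ y) : 0 ≤ recip y := by
  unfold recip
  split_ifs
  · exact le_top
  · exact EReal.inv_nonneg_of_nonneg hy

theorem le_recip_of_forall {x y : EReal} (hy : 0 ≤ y)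
    (h : ∀ r : ℝ, 0 < r → (r : EReal) < x → y ≤ ((1 / r : ℝ) : EReal)) : x ≤ recip y := by
  by_contra! hlt
  obtain ⟨c, hc1, hc2⟩ := EReal.lt_iff_exists_real_btwn.1 hlt
  have hc0 : 0 < c := EReal.coe_pos.1 ((recip_nonneg hy).trans_lt hc1)
  exact ((recip_lt_coe_iff hy hc0).1 hc1).not_ge (h c hc0 hc2)

theorem le_recip_of_forall_lt {x y : EReal} (hy : 0 ≤ y)
    (h : ∀ r : ℝ, 0 < r → (r : EReal) < y → x ≤ ((1 / r : ℝ) : EReal)) : x ≤ recip y := by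
  by_contra! hlt
  obtain ⟨c, hc1, hc2⟩ := EReal.lt_iff_exists_real_btwn.1 hlt
  have hc0 : 0 < c := EReal.coe_pos.1 ((recip_nonneg hy).trans_lt hc1)
  have := h (1 / c) (by positivity) ((recip_lt_coe_iff hy hc0).1 hc1)
  rw [one_div_one_div] at this
  exact hc2.not_ge this

theorem recip_le_of_forall_gt {x y : EReal} (hx : 0 ≤ x) (hy : 0 ≤ y)
    (h : ∀ r : ℝ, 0 < r → x < (r : EReal) → ((1 / r : ℝ) : EReal) ≤ y) : recip y ≤ x := by
  by_contra! hlt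
  obtain ⟨c, hc1, hc2⟩ := EReal.lt_iff_exists_real_btwn.1 hlt
  have hc0 : 0 < c := EReal.coe_pos.1 (hx.trans_lt hc1)
  exact ((coe_lt_recip_iff hy hc0).1 hc2).not_ge (h c hc0 hc1)

theorem recip_le_recip {x y : EReal} (hx : 0 ≤ x) (hxy : x ≤ y) : recip y ≤ recip x :=
  le_recip_of_forall hx fun _ hr hlt =>
    hxy.trans ((coe_lt_recip_iff (hx.trans hxy) hr).1 hlt).le

/-! ### Power bounds describing the Matuszewska indices -/

/-- `f (l x) ≤ C l ^ r f x` for all `l ∈ [1, L]` and all large `x`, where how large `x` has to be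
may depend on `L` but the constant `C` does not. -/
def LocalUpperBound (f : ℝ → ℝ) (r : ℝ) : Prop :=
  ∃ C : ℝ, 0 < C ∧ ∀ L : ℝ, 1 < L → ∀ᶠ x in atTop, ∀ l ∈ Set.Icc (1 : ℝ) L,
    f (l * x) ≤ C * l ^ r * f x

/-- `f (l x) ≤ C l ^ r f x` for all `l ≥ 1` and all large `x`. -/
def UpperBound (f : ℝ → ℝ) (r : ℝ) : Prop :=
  ∃ C : ℝ, 0 < C ∧ ∀ᶠ x in atTop, ∀ l : ℝ, 1 ≤ l → f (l * x) ≤ C * l ^ r * f x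

/-- `D l ^ r f x ≤ f (l x)` for all `l ∈ [1, L]` and all large `x`, where how large `x` has to be
may depend on `L` but the constant `D` does not. -/
def LocalLowerBound (f : ℝ → ℝ) (r : ℝ) : Prop :=
  ∃ D : ℝ, 0 < D ∧ ∀ L : ℝ, 1 < L → ∀ᶠ x in atTop, ∀ l ∈ Set.Icc (1 : ℝ) L,
    D * l ^ r * f x ≤ f (l * x)

/-- `D l ^ r f x ≤ f (l x)` for all `l ≥ 1` and all large `x`. -/
def LowerBound (f : ℝ → ℝ) (r : ℝ) : Prop :=
  ∃ D : ℝ, 0 < D ∧ ∀ᶠ x in atTop, ∀ l : ℝ, 1 ≤ l → D * l ^ r * f x ≤ f (l * x)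

theorem UpperBound.toLocal {f : ℝ → ℝ} {r : ℝ} (h : UpperBound f r) : LocalUpperBound f r := by
  obtain ⟨C, hC, h⟩ := h
  exact ⟨C, hC, fun L _ => h.mono fun x hx l hl => hx l hl.1⟩

theorem LowerBound.toLocal {f : ℝ → ℝ} {r : ℝ} (h : LowerBound f r) : LocalLowerBound f r := by
  obtain ⟨C, hC, h⟩ := h
  exact ⟨C, hC, fun L _ => h.mono fun x hx l hl => hx l hl.1⟩

/-- A bound for `l ∈ [1, L]` extends to all `l ≥ 1`, with the same constant, as soon as each
multiplication by `L` costs no more than the factor `L ^ s`. -/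
theorem le_of_forall_Icc_of_step {f : ℝ → ℝ} {C L s X : ℝ} (hC : 0 ≤ C) (hL : 1 < L) (hX : 0 ≤ X)
    (hbase : ∀ x, X ≤ x → ∀ l ∈ Set.Icc (1 : ℝ) L, f (l * x) ≤ C * l ^ s * f x)
    (hstep : ∀ x, X ≤ x → f (L * x) ≤ L ^ s * f x) {x l : ℝ} (hx : X ≤ x) (hl : 1 ≤ l) :
    f (l * x) ≤ C * l ^ s * f x := by
  have key : ∀ k : ℕ, ∀ x, X ≤ x → ∀ l, 1 ≤ l → l ≤ L ^ k → f (l * x) ≤ C * l ^ s * f x := by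
    intro k
    induction k with
    | zero => exact fun x hx l hl hlk => hbase x hx l ⟨hl, (by simpa using hlk : l ≤ 1).trans hL.le⟩
    | succ k ih =>
      intro x hx l hl hlk
      have hL0 : 0 < L := by linarith
      rcases le_or_gt l L with hlL | hlL
      · exact hbase x hx l ⟨hl, hlL⟩
      · have hm : 1 ≤ l / L := (one_le_div hL0).2 hlL.le
        have hLx : X ≤ L * x := hx.trans (by nlinarith)
        have hmk : l / L ≤ L ^ k := by rwa [div_le_iff₀ hL0, ← pow_succ]
        have h1 := ih (L * x) hLx (l / L) hm hmk
        calc f (l * x) = f (l / L * (L * x)) := by congr 1; field_simp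
          _ ≤ C * (l / L) ^ s * f (L * x) := h1
          _ ≤ C * (l / L) ^ s * (L ^ s * f x) := by gcongr; exact hstep x hx
          _ = C * l ^ s * f x := by
            rw [Real.div_rpow (by linarith) hL0.le]
            have := Real.rpow_pos_of_pos hL0 s
            field_simp
  obtain ⟨k, hk⟩ := pow_unbounded_of_one_lt l hL
  exact key k x hx l hl hk.le

/-- Passing to a larger exponent absorbs the constant of a local bound at one scale `L`, after
which the bound can be iterated. -/
theorem LocalUpperBound.toUpperBound {f : ℝ → ℝ} (hf : ∀ᶠ x in atTop, 0 < f x) {r s : ℝ}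
    (h : LocalUpperBound f r) (hrs : r < s) : UpperBound f s := by
  obtain ⟨C, hC, h⟩ := h
  obtain ⟨L, hLC, hL⟩ := (((tendsto_rpow_atTop (sub_pos.2 hrs)).eventually_ge_atTop C).and
    (eventually_gt_atTop 1)).exists
  have hL0 : 0 < L := by linarith
  obtain ⟨X, hX⟩ := eventually_atTop.1 ((h L hL).and (hf.and (eventually_ge_atTop 0)))
  refine ⟨C, hC, (eventually_ge_atTop X).mono fun x hx l hl => ?_⟩
  refine le_of_forall_Icc_of_step hC.le hL (hX X le_rfl).2.2 (fun y hy l hl => ?_)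
    (fun y hy => ?_) hx hl
  · refine ((hX y hy).1 l hl).trans ?_
    have := (hX y hy).2.1
    have hl1 := hl.1
    gcongr
  · refine ((hX y hy).1 L ⟨hL.le, le_rfl⟩).trans ?_
    refine mul_le_mul_of_nonneg_right ?_ (hX y hy).2.1.le
    calc C * L ^ r ≤ L ^ (s - r) * L ^ r := by gcongr
      _ = L ^ s := by rw [← Real.rpow_add hL0]; ring_nf

/-- The lower analogue of `LocalUpperBound.toUpperBound`, by passing to `1 / f`. -/
theorem LocalLowerBound.toLowerBound {f : ℝ → ℝ} (hf : ∀ᶠ x in atTop, 0 < f x) {r s : ℝ}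
    (h : LocalLowerBound f r) (hsr : s < r) : LowerBound f s := by
  obtain ⟨X, hX⟩ := eventually_atTop.1 (hf.and (eventually_ge_atTop 0))
  have hXl : ∀ x, X ≤ x → ∀ l : ℝ, 1 ≤ l → 0 < f x ∧ 0 < f (l * x) := fun x hx l hl =>
    ⟨(hX x hx).1, (hX (l * x) (hx.trans (by nlinarith [(hX x hx).2]))).1⟩
  have conv : ∀ D x l r : ℝ, 0 < D → X ≤ x → 1 ≤ l →
      (D * l ^ r * f x ≤ f (l * x) ↔ (f (l * x))⁻¹ ≤ D⁻¹ * l ^ (-r) * (f x)⁻¹) := by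
    intro D x l r hD hx hl
    obtain ⟨h1, h2⟩ := hXl x hx l hl
    have h3 : 0 < l ^ r := Real.rpow_pos_of_pos (by linarith) r
    rw [Real.rpow_neg (by linarith), ← mul_inv, ← mul_inv, inv_le_inv₀ h2 (by positivity)]
  obtain ⟨D, hD, h⟩ := h
  have h' : LocalUpperBound (fun x => (f x)⁻¹) (-r) :=
    ⟨D⁻¹, inv_pos.2 hD, fun L hL => by
      filter_upwards [h L hL, eventually_ge_atTop X] with x hx hxX l hl
      exact (conv D x l r hD hxX hl.1).1 (hx l hl)⟩
  obtain ⟨C, hC, h2⟩ := h'.toUpperBound (hf.mono fun x hx => inv_pos.2 hx) (neg_lt_neg hsr)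
  refine ⟨C⁻¹, inv_pos.2 hC, ?_⟩
  filter_upwards [h2, eventually_ge_atTop X] with x hx hxX l hl
  rw [conv C⁻¹ x l s (inv_pos.2 hC) hxX hl, inv_inv]
  exact hx l hl

theorem upperMatuszewska_le {f : ℝ → ℝ} (hf : ∀ᶠ x in atTop, 0 < f x) {r : ℝ}
    (h : LocalUpperBound f r) : upperMatuszewska f ≤ r := by
  obtain ⟨C, hC, h⟩ := h
  refine sInf_le ⟨r, rfl, C, hC, fun L hL => ?_⟩
  refine limsup_le_of_le (by isBoundedDefault) ?_
  filter_upwards [h L hL, hf] with x hx hfx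
  refine iSup₂_le fun l hl => EReal.coe_le_coe_iff.2 ?_
  have := Real.rpow_pos_of_pos (by linarith [hl.1] : 0 < l) r
  rw [div_le_iff₀ (by positivity), ← mul_assoc]
  exact hx l hl

theorem UpperBound.of_upperMatuszewska_lt {f : ℝ → ℝ} (hf : ∀ᶠ x in atTop, 0 < f x) {s : ℝ}
    (h : upperMatuszewska f < s) : UpperBound f s := by
  obtain ⟨_, ⟨r, rfl, C, hC, h⟩, hrs⟩ := sInf_lt_iff.1 h
  refine LocalUpperBound.toUpperBound hf ⟨C + 1, by linarith, fun L hL => ?_⟩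
    (EReal.coe_lt_coe_iff.1 hrs)
  have h1 := eventually_lt_of_limsup_lt
    ((h L hL).trans_lt (EReal.coe_lt_coe_iff.2 (lt_add_one C)))
  filter_upwards [h1, hf] with x hx hfx l hl
  have h2 := EReal.coe_le_coe_iff.1 ((le_iSup₂ (f := fun (l : ℝ) (_ : l ∈ Set.Icc (1 : ℝ) L) =>
    ((f (l * x) / (l ^ r * f x) : ℝ) : EReal)) l hl).trans hx.le)
  have := Real.rpow_pos_of_pos (by linarith [hl.1] : 0 < l) r
  rwa [div_le_iff₀ (by positivity), ← mul_assoc] at h2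

theorem le_lowerMatuszewska {f : ℝ → ℝ} (hf : ∀ᶠ x in atTop, 0 < f x) {r : ℝ}
    (h : LocalLowerBound f r) : r ≤ lowerMatuszewska f := by
  obtain ⟨C, hC, h⟩ := h
  refine le_sSup ⟨r, rfl, C, hC, fun L hL => ?_⟩
  refine le_liminf_of_le (by isBoundedDefault) ?_
  filter_upwards [h L hL, hf] with x hx hfx
  refine le_iInf₂ fun l hl => EReal.coe_le_coe_iff.2 ?_
  have := Real.rpow_pos_of_pos (by linarith [hl.1] : 0 < l) r
  rw [le_div_iff₀ (by positivity), ← mul_assoc]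
  exact hx l hl

theorem LowerBound.of_lt_lowerMatuszewska {f : ℝ → ℝ} (hf : ∀ᶠ x in atTop, 0 < f x) {s : ℝ}
    (h : s < lowerMatuszewska f) : LowerBound f s := by
  obtain ⟨_, ⟨r, rfl, C, hC, h⟩, hrs⟩ := lt_sSup_iff.1 h
  refine LocalLowerBound.toLowerBound hf ⟨C / 2, by linarith, fun L hL => ?_⟩
    (EReal.coe_lt_coe_iff.1 hrs)
  have h1 := eventually_lt_of_lt_liminf
    ((EReal.coe_lt_coe_iff.2 (half_lt_self hC)).trans_le (h L hL))
  filter_upwards [h1, hf] with x hx hfx l hl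
  have h2 := EReal.coe_le_coe_iff.1 (hx.le.trans (iInf₂_le
    (f := fun (l : ℝ) (_ : l ∈ Set.Icc (1 : ℝ) L) =>
    ((f (l * x) / (l ^ r * f x) : ℝ) : EReal)) l hl))
  have := Real.rpow_pos_of_pos (by linarith [hl.1] : 0 < l) r
  rwa [le_div_iff₀ (by positivity), ← mul_assoc] at h2

theorem lowerMatuszewska_nonneg {f : ℝ → ℝ} (hmono : MonotoneOn f (Set.Ici 0))
    (hf : ∀ᶠ x in atTop, 0 < f x) : 0 ≤ lowerMatuszewska f := by
  refine le_lowerMatuszewska (r := 0) hf ⟨1, one_pos, fun L _ => ?_⟩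
  filter_upwards [eventually_ge_atTop 0] with x hx l hl
  simp only [Real.rpow_zero, one_mul]
  have := hl.1
  exact hmono hx (by simp only [Set.mem_Ici]; positivity) (by nlinarith)

theorem upperMatuszewska_nonneg {f : ℝ → ℝ} (hmono : MonotoneOn f (Set.Ici 0))
    (hf : ∀ᶠ x in atTop, 0 < f x) : 0 ≤ upperMatuszewska f := by
  by_contra! hlt
  obtain ⟨s, hs1, hs2⟩ := EReal.lt_iff_exists_real_btwn.1 hlt
  obtain ⟨C, hC, h⟩ := UpperBound.of_upperMatuszewska_lt hf hs1
  have hs : 0 < -s := neg_pos.2 (EReal.coe_neg'.1 hs2)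
  obtain ⟨x, hx, hfx, hx0⟩ := (h.and (hf.and (eventually_ge_atTop 0))).exists
  obtain ⟨l, hlC, hl⟩ := (((tendsto_rpow_atTop hs).eventually_gt_atTop C).and
    (eventually_ge_atTop 1)).exists
  have h1 := hx l hl
  have h2 : f x ≤ f (l * x) := hmono hx0 (by simp only [Set.mem_Ici]; positivity) (by nlinarith)
  have hl0 : 0 < l ^ s := Real.rpow_pos_of_pos (by linarith) s
  rw [Real.rpow_neg (by linarith), lt_inv_comm₀ hC hl0] at hlC
  have h3 : C * l ^ s < 1 := by
    calc C * l ^ s < C * C⁻¹ := by gcongr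
      _ = 1 := mul_inv_cancel₀ hC.ne'
  nlinarith

/-- For monotone functions the condition defining `gammaFun` can be iterated, which identifies it
with a power bound of exponent `1 / g`. -/
theorem recip_upperMatuszewska_eq_gammaFun {f : ℝ → ℝ} (hmono : MonotoneOn f (Set.Ici 0))
    (hf : ∀ᶠ x in atTop, 0 < f x) : recip (upperMatuszewska f) = gammaFun f := by
  have h0 := upperMatuszewska_nonneg hmono hf
  apply le_antisymm
  · refine recip_le_of_forall (le_max_left _ _) h0 fun s hs hlt => ?_
    -- it suffices to reach every `g < 1 / s`
    refine EReal.ge_of_forall_gt_iff_ge.1 fun g hg => ?_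
    rcases le_or_gt g 0 with hg0 | hg0
    · exact (EReal.coe_nonpos.2 hg0).trans (le_max_left _ _)
    obtain ⟨C, hC, h⟩ := UpperBound.of_upperMatuszewska_lt hf hlt
    have hgs : 0 < 1 - g * s := by
      have := EReal.coe_lt_coe_iff.1 hg
      rw [lt_div_iff₀ hs] at this
      linarith
    obtain ⟨K, hKC, hK⟩ := (((tendsto_rpow_atTop hgs).eventually_gt_atTop (2 * C)).and
      (eventually_gt_atTop 1)).exists
    have hK0 : 0 < K := by linarith
    refine le_max_of_le_right (le_sSup ⟨g, rfl, hg0, K, hK, ?_⟩)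
    refine lt_of_le_of_lt (limsup_le_of_le (by isBoundedDefault) (a := ((K / 2 : ℝ) : EReal)) ?_)
      (EReal.coe_lt_coe_iff.2 (half_lt_self hK0))
    filter_upwards [h, hf] with x hx hfx
    rw [EReal.coe_le_coe_iff, div_le_iff₀ hfx]
    refine (hx (K ^ g) (Real.one_le_rpow hK.le hg0.le)).trans ?_
    refine mul_le_mul_of_nonneg_right ?_ hfx.le
    rw [← Real.rpow_mul hK0.le]
    have h2 : K ^ (1 - g * s) * K ^ (g * s) = K := by
      rw [← Real.rpow_add hK0]; simp
    have h3 := Real.rpow_pos_of_pos hK0 (g * s)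
    nlinarith
  · refine max_le ?_ (sSup_le ?_)
    · exact recip_nonneg h0
    · rintro _ ⟨g, rfl, hg, K, hK, hlim⟩
      refine le_recip_of_forall h0 fun r hr hrg => ?_
      refine upperMatuszewska_le hf ?_
      have hK0 : 0 < K := by linarith
      have hL : 1 < K ^ r := Real.one_lt_rpow hK hr
      have hLg : (K ^ r) ^ (1 / r) = K := by
        rw [← Real.rpow_mul hK0.le, mul_one_div_cancel hr.ne', Real.rpow_one]
      have hrg' : K ^ r ≤ K ^ g :=
        Real.rpow_le_rpow_of_exponent_le hK.le (EReal.coe_lt_coe_iff.1 hrg).le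
      obtain ⟨X, hX⟩ := eventually_atTop.1
        ((eventually_lt_of_limsup_lt hlim).and (hf.and (eventually_ge_atTop 0)))
      have hstep : ∀ x, X ≤ x → f (K ^ r * x) ≤ K * f x := fun x hx => by
        obtain ⟨h1, h2, h3⟩ := hX x hx
        rw [EReal.coe_lt_coe_iff, div_lt_iff₀ h2] at h1
        refine (hmono ?_ ?_ ?_).trans h1.le
        · simp only [Set.mem_Ici]; positivity
        · simp only [Set.mem_Ici]; positivity
        · gcongr
      refine UpperBound.toLocal ⟨K, hK0, (eventually_ge_atTop X).mono fun x hx l hl => ?_⟩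
      refine le_of_forall_Icc_of_step hK0.le hL (hX X le_rfl).2.2 (fun y hy l hl => ?_)
        (fun y hy => ?_) hx hl
      · obtain ⟨-, h2, h3⟩ := hX y hy
        have hl1 := hl.1
        have hle : f (l * y) ≤ f (K ^ r * y) := by
          refine hmono ?_ ?_ (mul_le_mul_of_nonneg_right hl.2 h3)
          · simp only [Set.mem_Ici]; positivity
          · simp only [Set.mem_Ici]; positivity
        refine (hle.trans (hstep y hy)).trans (mul_le_mul_of_nonneg_right ?_ h2.le)
        exact le_mul_of_one_le_right hK0.le (Real.one_le_rpow hl1 (by positivity))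
      · rw [hLg]
        exact hstep y hy

/-! ### Power bounds for sequences and their step functions -/

/-- `a q ≤ C ((q + 1) / (p + 1)) ^ r a p` for all large `p` and all `q ≥ p`. -/
def SeqUpperBound (a : ℕ → ℝ) (r : ℝ) : Prop :=
  ∃ C : ℝ, 0 < C ∧ ∀ᶠ p : ℕ in atTop, ∀ q : ℕ, p ≤ q →
    a q ≤ C * (((q : ℝ) + 1) / ((p : ℝ) + 1)) ^ r * a p

/-- `D ((q + 1) / (p + 1)) ^ r a p ≤ a q` for all large `p` and all `q ≥ p`. -/
def SeqLowerBound (a : ℕ → ℝ) (r : ℝ) : Prop :=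
  ∃ D : ℝ, 0 < D ∧ ∀ᶠ p : ℕ in atTop, ∀ q : ℕ, p ≤ q →
    D * (((q : ℝ) + 1) / ((p : ℝ) + 1)) ^ r * a p ≤ a q

theorem stepFun_quotFromOne_add_one (M : ℕ → ℝ) (p : ℕ) :
    stepFun (quotFromOne M) ((p : ℝ) + 1) = quot M p := by
  have : ⌊(p : ℝ) + 1⌋₊ = p + 1 := by exact_mod_cast Nat.floor_natCast (R := ℝ) (p + 1)
  simp [stepFun, quotFromOne, this]

theorem UpperBound.toSeq {M : ℕ → ℝ} {r : ℝ} (h : UpperBound (stepFun (quotFromOne M)) r) :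
    SeqUpperBound (quot M) r := by
  obtain ⟨C, hC, h⟩ := h
  refine ⟨C, hC, ?_⟩
  filter_upwards [(tendsto_natCast_atTop_atTop.atTop_add tendsto_const_nhds).eventually h]
    with p hp q hpq
  have hq := hp (((q : ℝ) + 1) / ((p : ℝ) + 1)) ((one_le_div (by positivity)).2 (by gcongr))
  rwa [div_mul_cancel₀ _ (by positivity), stepFun_quotFromOne_add_one,
    stepFun_quotFromOne_add_one] at hq

theorem LowerBound.toSeq {M : ℕ → ℝ} {r : ℝ} (h : LowerBound (stepFun (quotFromOne M)) r) :
    SeqLowerBound (quot M) r := by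
  obtain ⟨C, hC, h⟩ := h
  refine ⟨C, hC, ?_⟩
  filter_upwards [(tendsto_natCast_atTop_atTop.atTop_add tendsto_const_nhds).eventually h]
    with p hp q hpq
  have hq := hp (((q : ℝ) + 1) / ((p : ℝ) + 1)) ((one_le_div (by positivity)).2 (by gcongr))
  rwa [div_mul_cancel₀ _ (by positivity), stepFun_quotFromOne_add_one,
    stepFun_quotFromOne_add_one] at hq

/-- Rounding down at `x ≥ 2` changes the ratio of two arguments by a factor of at most `2`. -/
theorem exists_floor_sub_one {x l : ℝ} {P : ℕ} (hx : (P : ℝ) + 2 ≤ x) (hl : 1 ≤ l) :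
    ∃ p q : ℕ, P ≤ p ∧ p ≤ q ∧ ⌊x⌋₊ - 1 = p ∧ ⌊l * x⌋₊ - 1 = q ∧
      l / 2 ≤ ((q : ℝ) + 1) / ((p : ℝ) + 1) ∧ ((q : ℝ) + 1) / ((p : ℝ) + 1) ≤ 2 * l := by
  have hP : (0 : ℝ) ≤ P := P.cast_nonneg
  have hlx : x ≤ l * x := by nlinarith
  have h1 : P + 2 ≤ ⌊x⌋₊ := Nat.le_floor (by push_cast; exact hx)
  have h2 : ⌊x⌋₊ ≤ ⌊l * x⌋₊ := Nat.floor_le_floor hlx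
  have cast1 : ((⌊x⌋₊ - 1 : ℕ) : ℝ) + 1 = ⌊x⌋₊ := by
    rw [Nat.cast_sub (by omega)]; simp
  have cast2 : ((⌊l * x⌋₊ - 1 : ℕ) : ℝ) + 1 = ⌊l * x⌋₊ := by
    rw [Nat.cast_sub (by omega)]; simp
  refine ⟨⌊x⌋₊ - 1, ⌊l * x⌋₊ - 1, by omega, by omega, rfl, rfl, ?_, ?_⟩
  · rw [cast1, cast2, le_div_iff₀ (by exact_mod_cast (by omega : 0 < ⌊x⌋₊))]
    have := Nat.floor_le (by linarith : 0 ≤ x)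
    have := Nat.lt_floor_add_one (l * x)
    nlinarith
  · rw [cast1, cast2, div_le_iff₀ (by exact_mod_cast (by omega : 0 < ⌊x⌋₊))]
    have := Nat.floor_le (by linarith : 0 ≤ l * x)
    have := Nat.lt_floor_add_one x
    nlinarith

theorem SeqUpperBound.toStepFun {M : ℕ → ℝ} (hM : ∀ p, 0 < quot M p) {r : ℝ} (hr : 0 < r)
    (h : SeqUpperBound (quot M) r) : UpperBound (stepFun (quotFromOne M)) r := by
  obtain ⟨C, hC, h⟩ := h
  obtain ⟨P, hP⟩ := eventually_atTop.1 h
  refine ⟨C * 2 ^ r, by positivity, ?_⟩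
  filter_upwards [eventually_ge_atTop ((P : ℝ) + 2)] with x hx l hl
  obtain ⟨p, q, hPp, hpq, hp, hq, -, hle⟩ := exists_floor_sub_one hx hl
  simp only [stepFun, quotFromOne, hp, hq]
  refine (hP p hPp q hpq).trans ?_
  rw [mul_assoc C (2 ^ r), ← Real.mul_rpow (by norm_num) (by linarith)]
  have := hM p
  gcongr

theorem SeqLowerBound.toStepFun {M : ℕ → ℝ} (hM : ∀ p, 0 < quot M p) {r : ℝ} (hr : 0 < r)
    (h : SeqLowerBound (quot M) r) : LowerBound (stepFun (quotFromOne M)) r := by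
  obtain ⟨C, hC, h⟩ := h
  obtain ⟨P, hP⟩ := eventually_atTop.1 h
  refine ⟨C * (1 / 2) ^ r, by positivity, ?_⟩
  filter_upwards [eventually_ge_atTop ((P : ℝ) + 2)] with x hx l hl
  obtain ⟨p, q, hPp, hpq, hp, hq, hle, -⟩ := exists_floor_sub_one hx hl
  simp only [stepFun, quotFromOne, hp, hq]
  refine le_trans ?_ (hP p hPp q hpq)
  rw [mul_assoc C ((1 / 2) ^ r), ← Real.mul_rpow (by norm_num) (by linarith)]
  have := hM p
  have : 1 / 2 * l ≤ ((q : ℝ) + 1) / ((p : ℝ) + 1) := by linarith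
  gcongr

/-! ### Quotients and the counting function -/

variable {M : ℕ → ℝ}

theorem IsWeightSequence.quot_pos (hM : IsWeightSequence M) (p : ℕ) : 0 < quot M p :=
  div_pos (hM.pos _) (hM.pos _)

/-- The counting function is the generalized inverse of the sequence of quotients. -/
theorem IsWeightSequence.exists_countFun_eq (hM : IsWeightSequence M) (t : ℝ) :
    ∃ n : ℕ, countFun M t = n ∧ ∀ j, quot M j ≤ t ↔ j < n := by
  refine ⟨_, rfl, fun j => ⟨fun hj => ?_, fun hj => ?_⟩⟩
  · have hsub : Set.Iic j ⊆ {j : ℕ | quot M j ≤ t} := fun i hi => (hM.quot_mono hi).trans hj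
    have := Set.ncard_le_ncard hsub (hM.finite_quot_le t)
    have hcard : (Set.Iic j).ncard = j + 1 := by
      rw [← Finset.coe_Iic, Set.ncard_coe_finset, Nat.card_Iic]
    omega
  · by_contra! hlt
    have hsub : {j : ℕ | quot M j ≤ t} ⊆ Set.Iio j := fun i hi => by
      by_contra! hji
      exact (hlt.trans_le (hM.quot_mono (not_lt.1 hji))).not_ge hi
    have := Set.ncard_le_ncard hsub (Set.finite_Iio j)
    have hcard : (Set.Iio j).ncard = j := by
      rw [← Finset.coe_Iio, Set.ncard_coe_finset, Nat.card_Iio]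
    omega

theorem IsWeightSequence.tendsto_quot (hM : IsWeightSequence M) : Tendsto (quot M) atTop atTop := by
  refine tendsto_atTop_atTop_of_monotone hM.quot_mono fun b => ?_
  obtain ⟨n, -, hn⟩ := hM.exists_countFun_eq b
  exact ⟨n, (not_le.1 fun h => lt_irrefl n ((hn n).1 h)).le⟩

theorem countFun_nonneg (M : ℕ → ℝ) (t : ℝ) : 0 ≤ countFun M t := Nat.cast_nonneg _

theorem IsWeightSequence.countFun_mono (hM : IsWeightSequence M) : Monotone (countFun M) :=
  fun _ t hst => Nat.cast_le.2 <|
    Set.ncard_le_ncard (fun _ hj => le_trans hj hst) (hM.finite_quot_le t)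

theorem IsWeightSequence.countFun_pos (hM : IsWeightSequence M) :
    ∀ᶠ t in atTop, 0 < countFun M t := by
  filter_upwards [eventually_ge_atTop (quot M 0)] with t ht
  obtain ⟨n, hn, h⟩ := hM.exists_countFun_eq t
  rw [hn]
  exact_mod_cast (h 0).1 ht

theorem le_rpow_one_div {x y b : ℝ} (hx : 0 ≤ x) (hb : 0 < b) (h : x ^ b ≤ y) :
    x ≤ y ^ (1 / b) := by
  have := Real.rpow_le_rpow (by positivity) h (by positivity : 0 ≤ 1 / b)
  rwa [← Real.rpow_mul hx, mul_one_div_cancel hb.ne', Real.rpow_one] at this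

theorem rpow_one_div_le {x y b : ℝ} (hx : 0 ≤ x) (hy : 0 ≤ y) (hb : 0 < b) (h : y ≤ x ^ b) :
    y ^ (1 / b) ≤ x := by
  have := Real.rpow_le_rpow hy h (by positivity : 0 ≤ 1 / b)
  rwa [← Real.rpow_mul hx, mul_one_div_cancel hb.ne', Real.rpow_one] at this

theorem IsWeightSequence.seqLowerBound_quot (hM : IsWeightSequence M) {r : ℝ} (hr : 0 < r)
    (h : UpperBound (countFun M) r) : SeqLowerBound (quot M) (1 / r) := by
  obtain ⟨C, hC, h⟩ := h
  refine ⟨(2 * C ^ (1 / r))⁻¹, by positivity, ?_⟩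
  filter_upwards [(hM.tendsto_quot.atTop_div_const two_pos).eventually h] with p hp q hpq
  have hp0 := hM.quot_pos p
  have hq0 := hM.quot_pos q
  have hle := hM.quot_mono hpq
  have hl : 1 ≤ 2 * quot M q / quot M p := (one_le_div hp0).2 (by linarith)
  have h1 := hp _ hl
  -- strictly below `quot M p` at most `p` quotients are counted, hence the factor `1 / 2`
  obtain ⟨n, hn, hn'⟩ := hM.exists_countFun_eq (quot M p / 2)
  obtain ⟨k, hk, hk'⟩ := hM.exists_countFun_eq (quot M q)
  have hnp : n ≤ p := not_lt.1 fun hlt => by linarith [(hn' p).2 hlt]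
  have hqk : q + 1 ≤ k := (hk' q).1 le_rfl
  rw [show 2 * quot M q / quot M p * (quot M p / 2) = quot M q by field_simp, hn, hk] at h1
  have h2 : ((q : ℝ) + 1) / ((p : ℝ) + 1) ≤ C * (2 * quot M q / quot M p) ^ r := by
    rw [div_le_iff₀ (by positivity)]
    calc (q : ℝ) + 1 ≤ k := by exact_mod_cast hqk
      _ ≤ C * (2 * quot M q / quot M p) ^ r * n := h1
      _ ≤ C * (2 * quot M q / quot M p) ^ r * ((p : ℝ) + 1) := by
        gcongr
        exact_mod_cast hnp.trans (Nat.le_succ p)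
  have h3 : (((q : ℝ) + 1) / ((p : ℝ) + 1)) ^ (1 / r)
      ≤ C ^ (1 / r) * (2 * quot M q / quot M p) := by
    refine rpow_one_div_le (by positivity) (by positivity) hr ?_
    rwa [Real.mul_rpow (by positivity) (by positivity), ← Real.rpow_mul hC.le,
      one_div_mul_cancel hr.ne', Real.rpow_one]
  calc (2 * C ^ (1 / r))⁻¹ * (((q : ℝ) + 1) / ((p : ℝ) + 1)) ^ (1 / r) * quot M p
      ≤ (2 * C ^ (1 / r))⁻¹ * (C ^ (1 / r) * (2 * quot M q / quot M p)) * quot M p := by gcongr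
    _ = quot M q := by
      have : 0 < C ^ (1 / r) := by positivity
      field_simp

theorem IsWeightSequence.upperBound_countFun (hM : IsWeightSequence M) {b : ℝ} (hb : 0 < b)
    (h : SeqLowerBound (quot M) b) : UpperBound (countFun M) (1 / b) := by
  obtain ⟨D, hD, h⟩ := h
  obtain ⟨P, hP⟩ := eventually_atTop.1 h
  refine ⟨1 + 2 * (1 / D) ^ (1 / b), by positivity, ?_⟩
  filter_upwards [eventually_ge_atTop (quot M P)] with t ht l hl
  obtain ⟨n, hn, hn'⟩ := hM.exists_countFun_eq t
  obtain ⟨k, hk, hk'⟩ := hM.exists_countFun_eq (l * t)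
  have hPn : P < n := (hn' P).1 ht
  rw [hn, hk]
  have hl1 : 1 ≤ l ^ (1 / b) := Real.one_le_rpow hl (by positivity)
  have hE : 0 < (1 / D) ^ (1 / b) := by positivity
  rcases le_or_gt k n with hkn | hkn
  · have hkn' : (k : ℝ) ≤ n := by exact_mod_cast hkn
    refine hkn'.trans (le_mul_of_one_le_left n.cast_nonneg ?_)
    nlinarith
  obtain ⟨q, rfl⟩ : ∃ q, k = q + 1 := ⟨k - 1, by omega⟩
  have hq : quot M q ≤ l * t := (hk' q).2 (Nat.lt_succ_self q)
  have hnt : t < quot M n := not_le.1 fun hle => lt_irrefl n ((hn' n).1 hle)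
  have h1 := hP n hPn.le q (by omega)
  have h2 : (((q : ℝ) + 1) / ((n : ℝ) + 1)) ^ b ≤ 1 / D * l := by
    have hn0 := hM.quot_pos n
    have h3 : D * (((q : ℝ) + 1) / ((n : ℝ) + 1)) ^ b * quot M n ≤ l * quot M n :=
      h1.trans (hq.trans (by gcongr))
    have h4 := le_of_mul_le_mul_right h3 hn0
    rw [one_div_mul_eq_div, le_div_iff₀ hD]
    linarith
  have h3 := le_rpow_one_div (by positivity) hb h2
  rw [Real.mul_rpow (by positivity) (by positivity), div_le_iff₀ (by positivity)] at h3
  push_cast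
  have hn1 : (n : ℝ) + 1 ≤ 2 * n := by
    have : (1 : ℝ) ≤ n := by exact_mod_cast (by omega : 1 ≤ n)
    linarith
  calc (q : ℝ) + 1 ≤ (1 / D) ^ (1 / b) * l ^ (1 / b) * ((n : ℝ) + 1) := h3
    _ ≤ (1 / D) ^ (1 / b) * l ^ (1 / b) * (2 * n) := by gcongr
    _ = 2 * (1 / D) ^ (1 / b) * l ^ (1 / b) * n := by ring
    _ ≤ (1 + 2 * (1 / D) ^ (1 / b)) * l ^ (1 / b) * n := by gcongr; linarith

theorem IsWeightSequence.lowerBound_countFun (hM : IsWeightSequence M) {a : ℝ} (ha : 0 < a)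
    (h : SeqUpperBound (quot M) a) : LowerBound (countFun M) (1 / a) := by
  obtain ⟨C, hC, h⟩ := h
  obtain ⟨P, hP⟩ := eventually_atTop.1 h
  refine ⟨(1 / C) ^ (1 / a) / 2, by positivity, ?_⟩
  filter_upwards [eventually_ge_atTop (quot M P)] with t ht l hl
  have ht0 : 0 < t := (hM.quot_pos P).trans_le ht
  obtain ⟨n, hn, hn'⟩ := hM.exists_countFun_eq t
  obtain ⟨q, hq, hq'⟩ := hM.exists_countFun_eq (l * t)
  have hPn : P < n := (hn' P).1 ht
  have hnq : (n : ℝ) ≤ q := by rw [← hn, ← hq]; exact hM.countFun_mono (by nlinarith)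
  have hnq' : n ≤ q := by exact_mod_cast hnq
  rw [hn, hq]
  obtain ⟨p, rfl⟩ : ∃ p, n = p + 1 := ⟨n - 1, by omega⟩
  have hpt : quot M p ≤ t := (hn' p).2 (Nat.lt_succ_self p)
  have hqt : l * t < quot M q := not_le.1 fun hle => lt_irrefl q ((hq' q).1 hle)
  have h1 := hP p (by omega) q (by omega)
  have h2 : 1 / C * l ≤ (((q : ℝ) + 1) / ((p : ℝ) + 1)) ^ a := by
    have h3 : l * t ≤ C * (((q : ℝ) + 1) / ((p : ℝ) + 1)) ^ a * t :=
      hqt.le.trans (h1.trans (by gcongr))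
    have h4 := le_of_mul_le_mul_right h3 ht0
    rw [one_div_mul_eq_div, div_le_iff₀ hC]
    linarith
  have h3 := rpow_one_div_le (by positivity) (by positivity) ha h2
  rw [Real.mul_rpow (by positivity) (by positivity), le_div_iff₀ (by positivity)] at h3
  push_cast at hnq ⊢
  have hp : (0 : ℝ) ≤ p := p.cast_nonneg
  linarith

theorem IsWeightSequence.seqUpperBound_quot (hM : IsWeightSequence M) {b : ℝ} (hb : 0 < b)
    (h : LowerBound (countFun M) b) : SeqUpperBound (quot M) (1 / b) := by
  obtain ⟨D, hD, h⟩ := h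
  refine ⟨2 + 2 * (1 / D) ^ (1 / b), by positivity, ?_⟩
  filter_upwards [hM.tendsto_quot.eventually h] with p hp q hpq
  have hp0 := hM.quot_pos p
  have hq0 := hM.quot_pos q
  have hE : 0 < (1 / D) ^ (1 / b) := by positivity
  have h1 : 1 ≤ (((q : ℝ) + 1) / ((p : ℝ) + 1)) ^ (1 / b) :=
    Real.one_le_rpow ((one_le_div (by positivity)).2 (by gcongr)) (by positivity)
  rcases le_or_gt (quot M q) (2 * quot M p) with hle | hlt
  · refine hle.trans (mul_le_mul_of_nonneg_right ?_ hp0.le)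
    nlinarith
  have hl : 1 ≤ quot M q / (2 * quot M p) := (one_le_div (by positivity)).2 hlt.le
  have h2 := hp _ hl
  -- strictly below `quot M q` at most `q` quotients are counted, hence the factor `1 / 2`
  obtain ⟨n, hn, hn'⟩ := hM.exists_countFun_eq (quot M p)
  obtain ⟨k, hk, hk'⟩ := hM.exists_countFun_eq (quot M q / 2)
  have hpn : p + 1 ≤ n := (hn' p).1 le_rfl
  have hkq : k ≤ q := not_lt.1 fun hlt => by linarith [(hk' q).2 hlt]
  rw [show quot M q / (2 * quot M p) * quot M p = quot M q / 2 by field_simp, hn, hk] at h2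
  have h3 : (quot M q / (2 * quot M p)) ^ b ≤ 1 / D * (((q : ℝ) + 1) / ((p : ℝ) + 1)) := by
    rw [one_div_mul_eq_div, le_div_iff₀ hD, le_div_iff₀ (by positivity)]
    calc (quot M q / (2 * quot M p)) ^ b * D * ((p : ℝ) + 1)
        ≤ (quot M q / (2 * quot M p)) ^ b * D * n := by
          gcongr
          exact_mod_cast hpn
      _ = D * (quot M q / (2 * quot M p)) ^ b * n := by ring
      _ ≤ k := h2
      _ ≤ (q : ℝ) + 1 := by exact_mod_cast hkq.trans (Nat.le_succ q)
  have h4 := le_rpow_one_div (by positivity) hb h3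
  rw [Real.mul_rpow (by positivity) (by positivity), div_le_iff₀ (by positivity)] at h4
  refine h4.trans ?_
  rw [← mul_assoc]
  refine mul_le_mul_of_nonneg_right ?_ hp0.le
  nlinarith

/-! ### The growth index of a weight sequence -/

theorem ThilliezProperty.seqLowerBound {g : ℝ} (h : ThilliezProperty M g) : SeqLowerBound (quot M) g := by
  obtain ⟨l, ⟨a, ha, hl⟩, hmono⟩ := h
  have ha0 : 0 < a := by linarith
  refine ⟨(a ^ 2)⁻¹, by positivity, Eventually.of_forall fun p q hpq => ?_⟩
  have h1 : ((p : ℝ) + 1) ^ (-g) * l p ≤ ((q : ℝ) + 1) ^ (-g) * l q := hmono hpq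
  rw [Real.rpow_neg (by positivity), Real.rpow_neg (by positivity), inv_mul_eq_div,
    inv_mul_eq_div, div_le_div_iff₀ (by positivity) (by positivity)] at h1
  rw [Real.div_rpow (by positivity) (by positivity)]
  have hp : 0 < ((p : ℝ) + 1) ^ g := by positivity
  have hq : 0 < ((q : ℝ) + 1) ^ g := by positivity
  have h2 := (hl p).1
  have h3 := (hl q).2
  rw [inv_mul_le_iff₀ ha0] at h2
  have h4 : ((q : ℝ) + 1) ^ g * quot M p ≤ a ^ 2 * quot M q * ((p : ℝ) + 1) ^ g := by
    calc ((q : ℝ) + 1) ^ g * quot M p ≤ ((q : ℝ) + 1) ^ g * (a * l p) := by gcongr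
      _ = a * (l p * ((q : ℝ) + 1) ^ g) := by ring
      _ ≤ a * (l q * ((p : ℝ) + 1) ^ g) := by gcongr
      _ ≤ a * (a * quot M q * ((p : ℝ) + 1) ^ g) := by gcongr
      _ = a ^ 2 * quot M q * ((p : ℝ) + 1) ^ g := by ring
  rw [show (a ^ 2)⁻¹ * (((q : ℝ) + 1) ^ g / ((p : ℝ) + 1) ^ g) * quot M p
    = ((q : ℝ) + 1) ^ g * quot M p / (a ^ 2 * ((p : ℝ) + 1) ^ g) by field_simp,
    div_le_iff₀ (by positivity)]
  linarith

/-- Monotonicity of the quotients extends the bound from large `p` to all `p`. -/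
theorem SeqLowerBound.forall (hM : IsWeightSequence M) {g : ℝ} (hg : 0 < g)
    (h : SeqLowerBound (quot M) g) : ∃ D : ℝ, 0 < D ∧ ∀ p q : ℕ, p ≤ q →
      D * (((q : ℝ) + 1) / ((p : ℝ) + 1)) ^ g * quot M p ≤ quot M q := by
  obtain ⟨D, hD, h⟩ := h
  obtain ⟨P, hP⟩ := eventually_atTop.1 h
  have hP1 : 1 ≤ ((P : ℝ) + 1) ^ g := Real.one_le_rpow (by simp) hg.le
  refine ⟨min D 1 / ((P : ℝ) + 1) ^ g, by positivity, fun p q hpq => ?_⟩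
  have hp0 := hM.quot_pos p
  have hmin : 0 < min D 1 := by positivity
  rcases le_or_gt P p with hPp | hPp
  · refine le_trans ?_ (hP p hPp q hpq)
    gcongr
    exact (div_le_self hmin.le hP1).trans (min_le_left _ _)
  rcases le_or_gt P q with hPq | hPq
  · refine le_trans ?_ (hP P le_rfl q hPq)
    have h1 : (((q : ℝ) + 1) / ((p : ℝ) + 1)) ^ g ≤ ((q : ℝ) + 1) ^ g :=
      Real.rpow_le_rpow (by positivity) (div_le_self (by positivity) (by simp)) hg.le
    calc min D 1 / ((P : ℝ) + 1) ^ g * (((q : ℝ) + 1) / ((p : ℝ) + 1)) ^ g * quot M p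
        ≤ D / ((P : ℝ) + 1) ^ g * ((q : ℝ) + 1) ^ g * quot M P := by
          gcongr
          · exact min_le_left _ _
          · exact hM.quot_mono hPp.le
      _ = D * (((q : ℝ) + 1) / ((P : ℝ) + 1)) ^ g * quot M P := by
          rw [Real.div_rpow (by positivity) (by positivity)]; ring
  · refine le_trans ?_ (hM.quot_mono hpq)
    refine mul_le_of_le_one_left hp0.le ?_
    rw [div_mul_eq_mul_div, div_le_one (by positivity)]
    calc min D 1 * (((q : ℝ) + 1) / ((p : ℝ) + 1)) ^ g
        ≤ 1 * (((q : ℝ) + 1) / ((p : ℝ) + 1)) ^ g := by gcongr; exact min_le_right _ _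
      _ ≤ ((P : ℝ) + 1) ^ g := by
        rw [one_mul]
        refine Real.rpow_le_rpow (by positivity) ?_ hg.le
        refine (div_le_self (by positivity) (by simp)).trans ?_
        have : (q : ℝ) ≤ P := by exact_mod_cast hPq.le
        linarith

/-- The equivalent sequence is `(p + 1) ^ g` times the running maximum of
`(k + 1) ^ (-g) * quot M k`. -/
theorem SeqLowerBound.thilliezProperty (hM : IsWeightSequence M) {g : ℝ} (hg : 0 < g)
    (h : SeqLowerBound (quot M) g) : ThilliezProperty M g := by
  obtain ⟨D, hD, h⟩ := SeqLowerBound.forall hM hg h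
  set u : ℕ → ℝ := fun k => ((k : ℝ) + 1) ^ (-g) * quot M k with hu
  have hD' : 0 < D⁻¹ := inv_pos.2 hD
  refine ⟨fun p => ((p : ℝ) + 1) ^ g * partialSups u p, ⟨1 + D⁻¹, by linarith, fun p => ⟨?_, ?_⟩⟩,
    ?_⟩
  · have h1 : u p ≤ partialSups u p := le_partialSups u p
    have h2 : quot M p = ((p : ℝ) + 1) ^ g * u p := by
      rw [hu]
      simp only
      rw [← mul_assoc, ← Real.rpow_add (by positivity)]
      simp
    calc (1 + D⁻¹)⁻¹ * quot M p ≤ quot M p :=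
        mul_le_of_le_one_left (hM.quot_pos p).le (inv_le_one_of_one_le₀ (by linarith))
      _ = ((p : ℝ) + 1) ^ g * u p := h2
      _ ≤ ((p : ℝ) + 1) ^ g * partialSups u p := by gcongr
  · have h1 : partialSups u p ≤ D⁻¹ * quot M p / ((p : ℝ) + 1) ^ g := by
      refine partialSups_le u p _ fun k hk => ?_
      have h2 := h k p hk
      rw [Real.div_rpow (by positivity) (by positivity)] at h2
      have hk0 : 0 < ((k : ℝ) + 1) ^ g := by positivity
      rw [le_div_iff₀ (by positivity), inv_mul_eq_div, le_div_iff₀ hD, hu]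
      simp only
      rw [Real.rpow_neg (by positivity)]
      calc _ = D * (((p : ℝ) + 1) ^ g / ((k : ℝ) + 1) ^ g) * quot M k := by field_simp
        _ ≤ _ := h2
    rw [le_div_iff₀ (by positivity)] at h1
    have := hM.quot_pos p
    linarith
  · have h1 : (fun p : ℕ => ((p : ℝ) + 1) ^ (-g) * (((p : ℝ) + 1) ^ g * partialSups u p))
        = partialSups u := by
      funext p
      rw [← mul_assoc, ← Real.rpow_add (by positivity)]
      simp
    rw [h1]
    exact (partialSups u).monotone

theorem IsWeightSequence.gammaSeq_nonneg (hM : IsWeightSequence M) : 0 ≤ gammaSeq M :=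
  le_sSup ⟨0, rfl, quot M, ⟨1, le_rfl, fun p => by simp⟩, by simpa using hM.quot_mono⟩

/-! ### The associated function -/

theorem IsWeightSequence.log_le_assocFun (hM : IsWeightSequence M) {t : ℝ} (ht : 0 < t) (p : ℕ) :
    Real.log (t ^ p / M p) ≤ assocFun M t := by
  rw [assocFun, if_pos ht]
  exact le_ciSup (hM.bddAbove_log ht) p

/-- The supremum defining the associated function is attained at `p = countFun M t`, because
`t ^ p / M p` increases as long as `quot M p ≤ t`. -/
theorem IsWeightSequence.assocFun_eq (hM : IsWeightSequence M) {t : ℝ} (ht : 0 < t) {n : ℕ}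
    (hn : ∀ j, quot M j ≤ t ↔ j < n) : assocFun M t = Real.log (t ^ n / M n) := by
  have hpos : ∀ p, 0 < t ^ p / M p := fun p => div_pos (pow_pos ht p) (hM.pos p)
  have hsucc : ∀ p, t ^ (p + 1) / M (p + 1) * quot M p = t ^ p / M p * t := fun p => by
    have := hM.pos p
    have := hM.pos (p + 1)
    rw [quot]
    field_simp
    exact pow_succ t p
  have hup : ∀ p, p ≤ n → t ^ p / M p ≤ t ^ n / M n := fun p hp => by
    induction hp using Nat.decreasingInduction with
    | self => exact le_rfl
    | of_succ k hk ih =>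
      refine le_trans ?_ ih
      refine le_of_mul_le_mul_right ?_ ht
      rw [← hsucc k]
      exact mul_le_mul_of_nonneg_left ((hn k).2 hk) (hpos _).le
  have hdown : ∀ p, n ≤ p → t ^ p / M p ≤ t ^ n / M n := fun p hp => by
    induction p, hp using Nat.le_induction with
    | base => exact le_rfl
    | succ k hk ih =>
      refine le_trans ?_ ih
      refine le_of_mul_le_mul_right ?_ ht
      rw [← hsucc k]
      exact mul_le_mul_of_nonneg_left
        (not_le.1 fun h => ((hn k).1 h).not_ge hk).le (hpos _).le
  refine le_antisymm ?_ (hM.log_le_assocFun ht n)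
  rw [assocFun, if_pos ht]
  exact ciSup_le fun p => Real.log_le_log (hpos p) ((le_total p n).elim (hup p) (hdown p))

/-- With `countFun_mul_log_le` this replaces the representation of `assocFun M` as the integral of
`countFun M s / s`. -/
theorem IsWeightSequence.assocFun_sub_le (hM : IsWeightSequence M) {t s : ℝ} (ht : 0 < t)
    (hs : 0 < s) : assocFun M (s * t) - assocFun M t ≤ countFun M (s * t) * Real.log s := by
  obtain ⟨n, hn, hn'⟩ := hM.exists_countFun_eq (s * t)
  have h1 := hM.log_le_assocFun ht n
  have h2 : Real.log ((s * t) ^ n / M n) = n * Real.log s + Real.log (t ^ n / M n) := by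
    have := hM.pos n
    rw [mul_pow, mul_div_assoc, Real.log_mul (by positivity) (by positivity), Real.log_pow]
  rw [hM.assocFun_eq (by positivity) hn', hn, h2]
  linarith

theorem IsWeightSequence.countFun_mul_log_le (hM : IsWeightSequence M) {t s : ℝ} (ht : 0 < t)
    (hs : 0 < s) : countFun M t * Real.log s ≤ assocFun M (s * t) - assocFun M t := by
  obtain ⟨n, hn, hn'⟩ := hM.exists_countFun_eq t
  have h1 := hM.log_le_assocFun (mul_pos hs ht) n
  have h2 : Real.log ((s * t) ^ n / M n) = n * Real.log s + Real.log (t ^ n / M n) := by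
    have := hM.pos n
    rw [mul_pow, mul_div_assoc, Real.log_mul (by positivity) (by positivity), Real.log_pow]
  rw [hM.assocFun_eq ht hn', hn]
  linarith

theorem IsWeightSequence.assocFun_nonneg (hM : IsWeightSequence M) (t : ℝ) : 0 ≤ assocFun M t := by
  by_cases ht : 0 < t
  · simpa [hM.zero] using hM.log_le_assocFun ht 0
  · simp [assocFun, ht]

theorem IsWeightSequence.assocFun_mono (hM : IsWeightSequence M) : Monotone (assocFun M) := by
  intro s t hst
  by_cases hs : 0 < s
  · have hts : 1 ≤ t / s := (one_le_div hs).2 hst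
    have h := hM.countFun_mul_log_le hs (by linarith : 0 < t / s)
    rw [div_mul_cancel₀ _ hs.ne'] at h
    linarith [mul_nonneg (countFun_nonneg M s) (Real.log_nonneg hts)]
  · rw [assocFun, if_neg hs]
    exact hM.assocFun_nonneg t

theorem IsWeightSequence.tendsto_assocFun (hM : IsWeightSequence M) :
    Tendsto (assocFun M) atTop atTop := by
  refine tendsto_atTop_mono' _ ?_
    (Real.tendsto_log_atTop.comp (tendsto_id.atTop_div_const (hM.pos 1)))
  filter_upwards [eventually_gt_atTop 0] with t ht
  simpa using hM.log_le_assocFun ht 1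

theorem IsWeightSequence.assocFun_pos (hM : IsWeightSequence M) :
    ∀ᶠ t in atTop, 0 < assocFun M t :=
  hM.tendsto_assocFun.eventually_gt_atTop 0

/-! ### Comparison of the counting function and the associated function -/

/-- A lower bound on `[X, s X]` for a function that does not decrease under multiplication by `s`
holds on `[X, ∞)`. -/
theorem le_of_forall_Icc_of_le_mul {g : ℝ → ℝ} {X K s : ℝ} (hs : 1 < s) (hX : 0 < X)
    (hbase : ∀ t ∈ Set.Icc X (s * X), K ≤ g t) (hstep : ∀ t, X ≤ t → g t ≤ g (s * t))
    {t : ℝ} (ht : X ≤ t) : K ≤ g t := by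
  have hs0 : 0 < s := by linarith
  have key : ∀ n : ℕ, ∀ t, X ≤ t → t ≤ s ^ n * X → K ≤ g t := by
    intro n
    induction n with
    | zero => exact fun t ht htn => hbase t ⟨ht, by nlinarith⟩
    | succ n ih =>
      intro t ht htn
      rcases le_or_gt t (s * X) with h | h
      · exact hbase t ⟨ht, h⟩
      · have h1 : X ≤ t / s := by rw [le_div_iff₀ hs0]; linarith
        have h2 : t / s ≤ s ^ n * X := by
          rw [div_le_iff₀ hs0]
          calc t ≤ s ^ (n + 1) * X := htn
            _ = s ^ n * X * s := by ring
        have h3 := hstep (t / s) h1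
        rw [mul_div_cancel₀ _ hs0.ne'] at h3
        exact (ih _ h1 h2).trans h3
  obtain ⟨n, hn⟩ := pow_unbounded_of_one_lt (t / X) hs
  exact key n t ht ((div_lt_iff₀ hX).1 hn).le

theorem IsWeightSequence.localUpperBound_assocFun (hM : IsWeightSequence M) {r : ℝ} (hr : 0 < r)
    (h : UpperBound (countFun M) r) : LocalUpperBound (assocFun M) r := by
  obtain ⟨C, hC, h⟩ := h
  obtain ⟨X, hX⟩ := eventually_atTop.1 (h.and (eventually_gt_atTop 0))
  have hX0 : 0 < X := (hX X le_rfl).2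
  have he : (1 : ℝ) < Real.exp 1 := Real.one_lt_exp_iff.2 one_pos
  refine ⟨C * Real.exp 1 ^ r + 1, by positivity, fun L hL => ?_⟩
  filter_upwards [eventually_ge_atTop X,
    hM.tendsto_assocFun.eventually_ge_atTop (assocFun M (L * (Real.exp 1 * X)))] with t ht htL l hl
  have hl1 := hl.1
  have hl0 : 0 < l := by linarith
  have key : -assocFun M (L * (Real.exp 1 * X)) ≤
      C * (Real.exp 1 * l) ^ r * assocFun M t - assocFun M (l * t) := by
    refine le_of_forall_Icc_of_le_mul
      (g := fun t => C * (Real.exp 1 * l) ^ r * assocFun M t - assocFun M (l * t))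
      he hX0 (fun u hu => ?_) (fun u hu => ?_) ht
    · have h1 : assocFun M (l * u) ≤ assocFun M (L * (Real.exp 1 * X)) :=
        hM.assocFun_mono (mul_le_mul hl.2 hu.2 (hX0.le.trans hu.1) (by linarith))
      have h2 : 0 ≤ C * (Real.exp 1 * l) ^ r * assocFun M u :=
        mul_nonneg (by positivity) (hM.assocFun_nonneg u)
      linarith
    · have hu0 : 0 < u := hX0.trans_le hu
      have h1 := hM.assocFun_sub_le (mul_pos hl0 hu0) (Real.exp_pos 1)
      have h2 := hM.countFun_mul_log_le hu0 (Real.exp_pos 1)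
      rw [Real.log_exp, mul_one] at h1 h2
      have h3 := (hX u hu).1 (Real.exp 1 * l) (by nlinarith)
      rw [mul_assoc] at h3
      have h4 : C * (Real.exp 1 * l) ^ r * countFun M u ≤
          C * (Real.exp 1 * l) ^ r * (assocFun M (Real.exp 1 * u) - assocFun M u) := by gcongr
      rw [show l * (Real.exp 1 * u) = Real.exp 1 * (l * u) by ring]
      linarith
  have hlr : 1 ≤ l ^ r := Real.one_le_rpow hl1 hr.le
  rw [Real.mul_rpow (by positivity) (by positivity)] at key
  have := hM.assocFun_nonneg t
  nlinarith

theorem IsWeightSequence.lowerBound_assocFun (hM : IsWeightSequence M) {b : ℝ} (hb : 0 < b)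
    (h : LowerBound (countFun M) b) : LowerBound (assocFun M) b := by
  obtain ⟨D, hD, h⟩ := h
  obtain ⟨X, hX⟩ := eventually_atTop.1 (h.and (eventually_gt_atTop 0))
  have hX0 : 0 < X := (hX X le_rfl).2
  have he : (1 : ℝ) < Real.exp 1 := Real.one_lt_exp_iff.2 one_pos
  refine ⟨min (D / 2) 1 / Real.exp 1 ^ b, by positivity, ?_⟩
  filter_upwards [eventually_ge_atTop X, hM.tendsto_assocFun.eventually_ge_atTop
    (2 * assocFun M (Real.exp 1 * X))] with t ht htX l hl
  have hl0 : 0 < l := by linarith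
  have ht0 : 0 < t := hX0.trans_le ht
  have hω := hM.assocFun_nonneg t
  rw [show min (D / 2) 1 / Real.exp 1 ^ b * l ^ b * assocFun M t
    = min (D / 2) 1 * (l / Real.exp 1) ^ b * assocFun M t by
      rw [Real.div_rpow hl0.le (Real.exp_pos 1).le]; ring]
  rcases le_or_gt l (Real.exp 1) with hle | hlt
  · refine le_trans ?_ (hM.assocFun_mono (by nlinarith : t ≤ l * t))
    refine mul_le_of_le_one_left hω (mul_le_one₀ (min_le_right _ _) (by positivity) ?_)
    exact Real.rpow_le_one (by positivity) ((div_le_one (Real.exp_pos 1)).2 hle) hb.le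
  have key : -(D * (l / Real.exp 1) ^ b * assocFun M (Real.exp 1 * X)) ≤
      assocFun M (l * t) - D * (l / Real.exp 1) ^ b * assocFun M t := by
    refine le_of_forall_Icc_of_le_mul
      (g := fun t => assocFun M (l * t) - D * (l / Real.exp 1) ^ b * assocFun M t)
      he hX0 (fun u hu => ?_) (fun u hu => ?_) ht
    · have h1 : D * (l / Real.exp 1) ^ b * assocFun M u ≤
          D * (l / Real.exp 1) ^ b * assocFun M (Real.exp 1 * X) := by
        gcongr
        exact hM.assocFun_mono hu.2
      linarith [hM.assocFun_nonneg (l * u)]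
    · have hu0 : 0 < u := hX0.trans_le hu
      have h1 := hM.countFun_mul_log_le (mul_pos hl0 hu0) (Real.exp_pos 1)
      have h2 := hM.assocFun_sub_le hu0 (Real.exp_pos 1)
      rw [Real.log_exp, mul_one] at h1 h2
      have h3 := (hX (Real.exp 1 * u) (by nlinarith)).1 (l / Real.exp 1)
        ((one_le_div (Real.exp_pos 1)).2 hlt.le)
      rw [show l / Real.exp 1 * (Real.exp 1 * u) = l * u by field_simp] at h3
      have h4 : D * (l / Real.exp 1) ^ b * (assocFun M (Real.exp 1 * u) - assocFun M u) ≤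
          D * (l / Real.exp 1) ^ b * countFun M (Real.exp 1 * u) := by gcongr
      rw [show l * (Real.exp 1 * u) = Real.exp 1 * (l * u) by ring]
      linarith
  have hE : 0 < (l / Real.exp 1) ^ b := by positivity
  have h5 : D * (l / Real.exp 1) ^ b * assocFun M (Real.exp 1 * X) ≤
      D * (l / Real.exp 1) ^ b * (assocFun M t / 2) := by gcongr; linarith
  have h6 : min (D / 2) 1 * (l / Real.exp 1) ^ b * assocFun M t ≤
      D / 2 * (l / Real.exp 1) ^ b * assocFun M t := by gcongr; exact min_le_left _ _
  linarith

/-- Since `assocFun M` at least doubles between `t` and `K t` for some `K`, its increment there,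
and hence `countFun M (K t)`, is comparable to `assocFun M t` itself. -/
theorem IsWeightSequence.lowerBound_countFun_of_assocFun (hM : IsWeightSequence M) {b : ℝ}
    (hb : 0 < b) (h : LowerBound (assocFun M) b) : LowerBound (countFun M) b := by
  obtain ⟨D, hD, h⟩ := h
  obtain ⟨K, hKD, hK⟩ := (((tendsto_rpow_atTop hb).eventually_ge_atTop (2 / D)).and
    (eventually_gt_atTop 1)).exists
  have hK0 : 0 < K := by linarith
  have hlog : 0 < Real.log K := Real.log_pos hK
  have he : (1 : ℝ) < Real.exp 1 := Real.one_lt_exp_iff.2 one_pos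
  rw [div_le_iff₀ hD] at hKD
  obtain ⟨X, hX⟩ := eventually_atTop.1 (h.and (eventually_gt_atTop 0))
  have hX0 : 0 < X := (hX X le_rfl).2
  have hKe : 1 ≤ K * Real.exp 1 := by nlinarith
  refine ⟨min (D / Real.log K) 1 / (K * Real.exp 1) ^ b, by positivity, ?_⟩
  filter_upwards [eventually_ge_atTop X] with t ht l hl
  have hl0 : 0 < l := by linarith
  have ht0 : 0 < t := hX0.trans_le ht
  have hν := countFun_nonneg M t
  rw [show min (D / Real.log K) 1 / (K * Real.exp 1) ^ b * l ^ b * countFun M t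
    = min (D / Real.log K) 1 * (l / (K * Real.exp 1)) ^ b * countFun M t by
      rw [Real.div_rpow hl0.le (by positivity)]; ring]
  rcases le_or_gt l (K * Real.exp 1) with hle | hlt
  · refine le_trans ?_ (hM.countFun_mono (by nlinarith : t ≤ l * t))
    refine mul_le_of_le_one_left hν (mul_le_one₀ (min_le_right _ _) (by positivity) ?_)
    exact Real.rpow_le_one (by positivity) ((div_le_one (by positivity)).2 hle) hb.le
  set k := l / (K * Real.exp 1) with hk
  have hk1 : 1 ≤ k := (one_le_div (by positivity)).2 hlt.le
  have h1 := hM.countFun_mul_log_le ht0 (Real.exp_pos 1)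
  rw [Real.log_exp, mul_one] at h1
  have het : X ≤ Real.exp 1 * t := by nlinarith
  have h2 := (hX _ het).1 k hk1
  have hket : X ≤ k * (Real.exp 1 * t) := by nlinarith
  have h3 := (hX _ hket).1 K hK.le
  have h4 := hM.assocFun_sub_le (hX0.trans_le hket) hK0
  rw [show K * (k * (Real.exp 1 * t)) = l * t by rw [hk]; field_simp] at h3 h4
  have hkb : 0 < k ^ b := by positivity
  have h5 : 2 * assocFun M (k * (Real.exp 1 * t)) ≤ assocFun M (l * t) := by
    refine le_trans (mul_le_mul_of_nonneg_right ?_ (hM.assocFun_nonneg _)) h3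
    linarith
  have h6 : D * k ^ b * countFun M t ≤ countFun M (l * t) * Real.log K := by
    calc D * k ^ b * countFun M t ≤ D * k ^ b * assocFun M (Real.exp 1 * t) := by
          gcongr
          linarith [hM.assocFun_nonneg t]
      _ ≤ countFun M (l * t) * Real.log K := by linarith
  calc min (D / Real.log K) 1 * k ^ b * countFun M t
      ≤ D / Real.log K * k ^ b * countFun M t := by gcongr; exact min_le_left _ _
    _ = D * k ^ b * countFun M t / Real.log K := by ring
    _ ≤ countFun M (l * t) := (div_le_iff₀ hlog).2 h6

/-- Moderate growth makes the associated function at least double under multiplication of the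
argument by some constant. -/
theorem ModerateGrowth.exists_two_mul_assocFun_le (hM : IsWeightSequence M)
    (h : ModerateGrowth M) :
    ∃ A : ℝ, 1 < A ∧ ∀ t, 0 < t → 2 * assocFun M t ≤ assocFun M (A * t) := by
  obtain ⟨A, hA, h⟩ := h
  refine ⟨max A 2, lt_max_of_lt_right one_lt_two, fun t ht => ?_⟩
  refine le_trans ?_ (hM.assocFun_mono
    (mul_le_mul_of_nonneg_right (le_max_left A 2) ht.le))
  obtain ⟨n, -, hn⟩ := hM.exists_countFun_eq t
  rw [hM.assocFun_eq ht hn]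
  refine le_trans ?_ (hM.log_le_assocFun (mul_pos hA ht) (n + n))
  have h1 := hM.pos n
  have h2 := hM.pos (n + n)
  have h3 : 2 * Real.log (t ^ n / M n) = Real.log ((t ^ n / M n) ^ 2) := by
    rw [Real.log_pow]; norm_num
  rw [h3]
  refine Real.log_le_log (by positivity) ?_
  rw [div_pow, div_le_div_iff₀ (by positivity) h2]
  calc (t ^ n) ^ 2 * M (n + n) ≤ (t ^ n) ^ 2 * (A ^ (n + n) * M n * M n) := by
        gcongr
        exact h n n
    _ = (A * t) ^ (n + n) * M n ^ 2 := by ring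

theorem ModerateGrowth.upperBound_countFun (hM : IsWeightSequence M) (hmg : ModerateGrowth M)
    {r : ℝ} (h : UpperBound (assocFun M) r) : UpperBound (countFun M) r := by
  obtain ⟨C, hC, h⟩ := h
  obtain ⟨A, hA, hmg⟩ := hmg.exists_two_mul_assocFun_le hM
  have hA0 : 0 < A := by linarith
  have hlog : 0 < Real.log A := Real.log_pos hA
  have he : (1 : ℝ) < Real.exp 1 := Real.one_lt_exp_iff.2 one_pos
  refine ⟨C * (A * Real.exp 1) ^ r * Real.log A, by positivity, ?_⟩
  filter_upwards [(tendsto_id.atTop_div_const hA0).eventually h, eventually_gt_atTop 0]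
    with t ht ht0 l hl
  have hl0 : 0 < l := by linarith
  have hlt : 0 < l * t := mul_pos hl0 ht0
  have h1 := hM.countFun_mul_log_le hlt (Real.exp_pos 1)
  rw [Real.log_exp, mul_one] at h1
  have h2 := ht (A * Real.exp 1 * l) (by nlinarith [mul_pos hA0 (Real.exp_pos 1)])
  simp only [id] at h2
  rw [show A * Real.exp 1 * l * (t / A) = Real.exp 1 * (l * t) by field_simp] at h2
  have h3 := hM.assocFun_sub_le (div_pos ht0 hA0) hA0
  have h4 := hmg (t / A) (div_pos ht0 hA0)
  rw [mul_div_cancel₀ _ hA0.ne'] at h3 h4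
  calc countFun M (l * t) ≤ assocFun M (Real.exp 1 * (l * t)) := by
        linarith [hM.assocFun_nonneg (l * t)]
    _ ≤ C * (A * Real.exp 1 * l) ^ r * assocFun M (t / A) := h2
    _ ≤ C * (A * Real.exp 1 * l) ^ r * (countFun M t * Real.log A) := by gcongr; linarith
    _ = C * (A * Real.exp 1) ^ r * Real.log A * l ^ r * countFun M t := by
      rw [Real.mul_rpow (by positivity) hl0.le]; ring

/-! ### Relations between the indices -/

theorem IsWeightSequence.stepFun_pos (hM : IsWeightSequence M) :
    ∀ᶠ x in atTop, 0 < stepFun (quotFromOne M) x :=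
  Eventually.of_forall fun _ => hM.quot_pos _

theorem IsWeightSequence.stepFun_mono (hM : IsWeightSequence M) :
    Monotone (stepFun (quotFromOne M)) := fun _ _ hxy =>
  hM.quot_mono (Nat.sub_le_sub_right (Nat.floor_le_floor hxy) 1)

theorem IsWeightSequence.upperMatuszewska_assocFun_le (hM : IsWeightSequence M) :
    upperMatuszewska (assocFun M) ≤ upperMatuszewska (countFun M) := by
  refine EReal.le_of_forall_lt_iff_le.1 fun r hr => ?_
  have hr0 := EReal.coe_pos.1
    ((upperMatuszewska_nonneg (hM.countFun_mono.monotoneOn _) hM.countFun_pos).trans_lt hr)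
  exact upperMatuszewska_le hM.assocFun_pos
    (hM.localUpperBound_assocFun hr0 (.of_upperMatuszewska_lt hM.countFun_pos hr))

theorem IsWeightSequence.lowerMatuszewska_countFun_eq (hM : IsWeightSequence M) :
    lowerMatuszewska (countFun M) = lowerMatuszewska (assocFun M) := by
  apply le_antisymm <;> refine EReal.ge_of_forall_gt_iff_ge.1 fun b hb => ?_ <;>
    rcases le_or_gt b 0 with hb0 | hb0
  · exact (EReal.coe_nonpos.2 hb0).trans
      (lowerMatuszewska_nonneg (hM.assocFun_mono.monotoneOn _) hM.assocFun_pos)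
  · exact le_lowerMatuszewska hM.assocFun_pos
      (hM.lowerBound_assocFun hb0 (.of_lt_lowerMatuszewska hM.countFun_pos hb)).toLocal
  · exact (EReal.coe_nonpos.2 hb0).trans
      (lowerMatuszewska_nonneg (hM.countFun_mono.monotoneOn _) hM.countFun_pos)
  · exact le_lowerMatuszewska hM.countFun_pos
      (hM.lowerBound_countFun_of_assocFun hb0
        (.of_lt_lowerMatuszewska hM.assocFun_pos hb)).toLocal

theorem IsWeightSequence.gammaSeq_eq (hM : IsWeightSequence M) :
    gammaSeq M = lowerMatuszewskaSeq (quotFromOne M) := by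
  have h0 := lowerMatuszewska_nonneg (hM.stepFun_mono.monotoneOn _) hM.stepFun_pos
  apply le_antisymm
  · refine sSup_le ?_
    rintro _ ⟨g, rfl, hg⟩
    rcases le_or_gt g 0 with hg0 | hg0
    · exact (EReal.coe_nonpos.2 hg0).trans h0
    · exact le_lowerMatuszewska hM.stepFun_pos
        ((hg.seqLowerBound).toStepFun hM.quot_pos hg0).toLocal
  · refine EReal.ge_of_forall_gt_iff_ge.1 fun g hg => ?_
    rcases le_or_gt g 0 with hg0 | hg0
    · exact (EReal.coe_nonpos.2 hg0).trans hM.gammaSeq_nonneg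
    · exact le_sSup ⟨g, rfl, SeqLowerBound.thilliezProperty hM hg0
        (LowerBound.of_lt_lowerMatuszewska hM.stepFun_pos hg).toSeq⟩

theorem IsWeightSequence.lowerMatuszewskaSeq_quot_eq (hM : IsWeightSequence M) :
    lowerMatuszewskaSeq (quotFromOne M) = recip (upperMatuszewska (countFun M)) := by
  have h0 := lowerMatuszewska_nonneg (hM.stepFun_mono.monotoneOn _) hM.stepFun_pos
  have h1 := upperMatuszewska_nonneg (hM.countFun_mono.monotoneOn _) hM.countFun_pos
  apply le_antisymm
  · refine le_recip_of_forall h1 fun b hb hlt => ?_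
    exact upperMatuszewska_le hM.countFun_pos (hM.upperBound_countFun hb
      (LowerBound.of_lt_lowerMatuszewska hM.stepFun_pos hlt).toSeq).toLocal
  · refine recip_le_of_forall h0 h1 fun r hr hlt => ?_
    exact le_lowerMatuszewska hM.stepFun_pos ((hM.seqLowerBound_quot hr
      (.of_upperMatuszewska_lt hM.countFun_pos hlt)).toStepFun hM.quot_pos (by positivity)).toLocal

theorem IsWeightSequence.upperMatuszewskaSeq_quot_eq (hM : IsWeightSequence M) :
    upperMatuszewskaSeq (quotFromOne M) = recip (lowerMatuszewska (countFun M)) := by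
  have h0 := upperMatuszewska_nonneg (hM.stepFun_mono.monotoneOn _) hM.stepFun_pos
  have h1 := lowerMatuszewska_nonneg (hM.countFun_mono.monotoneOn _) hM.countFun_pos
  apply le_antisymm
  · refine le_recip_of_forall_lt h1 fun b hb hlt => ?_
    exact upperMatuszewska_le hM.stepFun_pos ((hM.seqUpperBound_quot hb
      (.of_lt_lowerMatuszewska hM.countFun_pos hlt)).toStepFun hM.quot_pos (by positivity)).toLocal
  · refine recip_le_of_forall_gt h0 h1 fun r hr hlt => ?_
    exact le_lowerMatuszewska hM.countFun_pos (hM.lowerBound_countFun hr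
      (UpperBound.of_upperMatuszewska_lt hM.stepFun_pos hlt).toSeq).toLocal

theorem ModerateGrowth.upperMatuszewska_eq (hM : IsWeightSequence M) (h : ModerateGrowth M) :
    upperMatuszewska (countFun M) = upperMatuszewska (assocFun M) :=
  le_antisymm (EReal.le_of_forall_lt_iff_le.1 fun _ hr =>
    upperMatuszewska_le hM.countFun_pos
      (h.upperBound_countFun hM (.of_upperMatuszewska_lt hM.assocFun_pos hr)).toLocal)
    hM.upperMatuszewska_assocFun_le

end GrowthIndex

theorem corollary4p6 (M : ℕ → ℝ) (hM : GrowthIndex.IsWeightSequence M) :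
    -- the four indices of the counting function and of the associated function are in [0, ∞]
    (0 ≤ GrowthIndex.upperMatuszewska (GrowthIndex.countFun M) ∧
      0 ≤ GrowthIndex.lowerMatuszewska (GrowthIndex.countFun M) ∧
      0 ≤ GrowthIndex.upperMatuszewska (GrowthIndex.assocFun M) ∧
      0 ≤ GrowthIndex.lowerMatuszewska (GrowthIndex.assocFun M)) ∧
    -- comparison of the counting function and the associated function
    (GrowthIndex.upperMatuszewska (GrowthIndex.assocFun M) ≤
        GrowthIndex.upperMatuszewska (GrowthIndex.countFun M) ∧
      GrowthIndex.lowerMatuszewska (GrowthIndex.countFun M) =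
        GrowthIndex.lowerMatuszewska (GrowthIndex.assocFun M)) ∧
    -- the growth index of M and the upper indices
    (GrowthIndex.gammaSeq M =
        GrowthIndex.lowerMatuszewskaSeq (GrowthIndex.quotFromOne M) ∧
      GrowthIndex.lowerMatuszewskaSeq (GrowthIndex.quotFromOne M) =
        GrowthIndex.recip (GrowthIndex.upperMatuszewska (GrowthIndex.countFun M)) ∧
      GrowthIndex.recip (GrowthIndex.upperMatuszewska (GrowthIndex.countFun M)) ≤
        GrowthIndex.recip (GrowthIndex.upperMatuszewska (GrowthIndex.assocFun M)) ∧
      GrowthIndex.recip (GrowthIndex.upperMatuszewska (GrowthIndex.assocFun M)) =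
        GrowthIndex.gammaFun (GrowthIndex.assocFun M)) ∧
    -- the upper index of the quotients and the lower indices
    (GrowthIndex.upperMatuszewskaSeq (GrowthIndex.quotFromOne M) =
        GrowthIndex.recip (GrowthIndex.lowerMatuszewska (GrowthIndex.countFun M)) ∧
      GrowthIndex.recip (GrowthIndex.lowerMatuszewska (GrowthIndex.countFun M)) =
        GrowthIndex.recip (GrowthIndex.lowerMatuszewska (GrowthIndex.assocFun M))) ∧
    -- equality under moderate growth
    (GrowthIndex.ModerateGrowth M →
      GrowthIndex.gammaSeq M = GrowthIndex.gammaFun (GrowthIndex.assocFun M)) := by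
  have hν := hM.countFun_mono.monotoneOn (Set.Ici 0)
  have hω := hM.assocFun_mono.monotoneOn (Set.Ici 0)
  have h0 := GrowthIndex.upperMatuszewska_nonneg hω hM.assocFun_pos
  have hγω := GrowthIndex.recip_upperMatuszewska_eq_gammaFun hω hM.assocFun_pos
  refine ⟨⟨GrowthIndex.upperMatuszewska_nonneg hν hM.countFun_pos,
    GrowthIndex.lowerMatuszewska_nonneg hν hM.countFun_pos, h0,
    GrowthIndex.lowerMatuszewska_nonneg hω hM.assocFun_pos⟩,
    ⟨hM.upperMatuszewska_assocFun_le, hM.lowerMatuszewska_countFun_eq⟩,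
    ⟨hM.gammaSeq_eq, hM.lowerMatuszewskaSeq_quot_eq,
      GrowthIndex.recip_le_recip h0 hM.upperMatuszewska_assocFun_le, hγω⟩,
    ⟨hM.upperMatuszewskaSeq_quot_eq, by rw [hM.lowerMatuszewska_countFun_eq]⟩, fun hmg => ?_⟩
  rw [hM.gammaSeq_eq, hM.lowerMatuszewskaSeq_quot_eq, hmg.upperMatuszewska_eq hM, hγω]
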